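/- Let $f:\mathbb R^n\to\mathbb R$ be continuously differentiable and convex, let $g:\mathbb R^m\to\mathbb R\cup\{+\infty\}$ be proper, lower semicontinuous (lsc) and convex with domain $\operatorname{dom} g=\{z : g(z)<\infty\}$, and let $c:\mathbb R^n\to\mathbb R^m$ be continuously differentiable with $$c(\lambda x+(1-\lambda)x')-\lambda c(x)-(1-\lambda)c(x')\in\operatorname{hzn} g:=\{v : g(z+v)\le g(z)\ \text{for all } z\in\operatorname{dom} g\}$$ for all $x,x'\in\mathbb R^n$, $\lambda\in[0,1]$. Put $\Phi(x):=f(x)+g(c(x))$, and assume that $\Phi$ has a minimizer with finite value; let $\Phi^*:=\min_x\Phi(x)$. A point $\bar x$ is called stationary if there is $\bar y\in\partial g(c(\bar x))$ with $\nabla f(\bar x)+c'(\bar x)^\top\bar y=0$. For $\mu>0$ let $$\mathcal L_\mu(x,y):=f(x)+\inf_z\Big\{g(z)+\langle y,c(x)-z\rangle+\tfrac1{2\mu}\|c(x)-z\|^2\Big\}.$$ Assume that no minimizer of $\Phi$ is stationary, and that the value function $\mathcal V(u):=\inf_x\{f(x)+g(c(x)-u)\}$ is proper and lsc. Consider the following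 safeguarded augmented Lagrangian method. Let $y^0\in\mathbb R^m$, $\mu_0>0$, $\beta,\theta\in(0,1)$, and let $Y_{\mathrm{sg}}\subseteq\mathbb R^m$ be nonempty, convex and compact. For $k=0,1,2,\dots$: 1. set $\hat y^k:=\Pi_{Y_{\mathrm{sg}}}(y^k)$ (Euclidean projection); 2. select $\varepsilon_k\ge0$ and compute $x^k$ with $\mathcal L_{\mu_k}(x^k,\hat y^k)\le\inf_x\mathcal L_{\mu_k}(x,\hat y^k)+\varepsilon_k$; 3. set $z^k:=\operatorname{prox}_{\mu_k g}(c(x^k)+\mu_k\hat y^k)$, the unique minimizer of $w\mapsto \mu_k g(w)+\tfrac12\|w-c(x^k)-\mu_k\hat y^k\|^2$; 4. set $y^{k+1}:=\hat y^k+\mu_k^{-1}(c(x^k)-z^k)$; 5. set $\mu_{k+1}:=\mu_k$ if $k=0$ or $\|c(x^k)-z^k\|\le\theta\|c(x^{k-1})-z^{k-1}\|$, and $\mu_{k+1}:=\beta\mu_k$ otherwise. Let $\{(x^k,z^k,y^k,\hat y^k)\}$ be a sequence generated by this method with $\varepsilon_k\to0$ (no summability is assumed). Then $$\limsup_{k\to\infty}\big(f(x^k)+g(z^k)\big)\le\Phi^*,$$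 and each accumulation point $\bar x$ of $\{x^k\}$ is a minimizer of $\Phi$. Moreover, for each subsequence $\{x^k\}_{k\in K}$ with $x^k\to_K\bar x$, we have $z^k\to_K c(\bar x)$ and $f(x^k)+g(z^k)\to_K\Phi^*$. -/

import Mathlib

open Filter Topology

namespace ConvexComposite

/-! Extended-real-valued functions. Functions with values in `ℝ ∪ {+∞}` (or `ℝ ∪ {±∞}`) are modelled
as functions into `EReal`; the value `-∞` of such a function is excluded by `IsProper`. -/

section ExtendedReal

variable {E : Type*} [NormedAddCommGroup E] [InnerProductSpace ℝ E]

/-- The domain `{z | φ z < ∞}`. -/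
def dom (φ : E → EReal) : Set E := {z | φ z < ⊤}

/-- `φ` is proper: its domain is nonempty and `φ` is finite on it. -/
def IsProper (φ : E → EReal) : Prop := (dom φ).Nonempty ∧ ∀ z, φ z ≠ ⊥

/-- The epigraph of `φ`, a subset of `E × ℝ`. -/
def epi (φ : E → EReal) : Set (E × ℝ) := {p | φ p.1 ≤ (p.2 : EReal)}

/-- An extended-real-valued function is convex if its epigraph is convex. -/
def IsConvexFun (φ : E → EReal) : Prop := Convex ℝ (epi φ)

/-- The horizon `{v | φ (z + v) ≤ φ z for all z ∈ dom φ}`. -/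
def hzn (φ : E → EReal) : Set E := {v | ∀ z ∈ dom φ, φ (z + v) ≤ φ z}

/-- The convex subdifferential of `φ` at `zbar`. It is only defined at points at which `φ` is finite,
and is taken to be empty elsewhere. -/
def subdiff (φ : E → EReal) (zbar : E) : Set E :=
  {y | φ zbar ≠ ⊤ ∧ φ zbar ≠ ⊥ ∧
    ∀ z ∈ dom φ, φ zbar + ((inner ℝ y (z - zbar) : ℝ) : EReal) ≤ φ z}

/-- `w = prox_φ (z)`, i.e. `w` minimizes `φ + ½ ‖· - z‖²`. For proper, lsc, convex `φ` there is
exactly one such `w`. -/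
def IsProx (φ : E → EReal) (z w : E) : Prop :=
  ∀ v, φ w + ((1 / 2 * ‖w - z‖ ^ 2 : ℝ) : EReal) ≤ φ v + ((1 / 2 * ‖v - z‖ ^ 2 : ℝ) : EReal)

/-- `p = Π_C (y)`: `p` is a point of `C` that realizes the distance of `y` to `C`. For nonempty,
closed, convex `C` (and complete `E`) there is exactly one such `p`. -/
def IsProj (C : Set E) (y p : E) : Prop := p ∈ C ∧ ‖p - y‖ = Metric.infDist y C

end ExtendedReal

/-! The composite problem: minimize `Φ x = f x + g (c x)`. -/

section Problem

variable {n m : ℕ}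

/-- The objective `Φ x = f x + g (c x)`. -/
noncomputable def objective (f : EuclideanSpace ℝ (Fin n) → ℝ) (g : EuclideanSpace ℝ (Fin m) → EReal)
    (c : EuclideanSpace ℝ (Fin n) → EuclideanSpace ℝ (Fin m))
    (x : EuclideanSpace ℝ (Fin n)) : EReal :=
  (f x : EReal) + g (c x)

/-- The minimal value `Φ*` of the problem. -/
noncomputable def minValue (f : EuclideanSpace ℝ (Fin n) → ℝ)
    (g : EuclideanSpace ℝ (Fin m) → EReal)
    (c : EuclideanSpace ℝ (Fin n) → EuclideanSpace ℝ (Fin m)) : EReal :=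
  ⨅ x, objective f g c x

/-- `xbar` is a (feasible, global) minimizer of the problem. -/
def IsMinimizer (f : EuclideanSpace ℝ (Fin n) → ℝ) (g : EuclideanSpace ℝ (Fin m) → EReal)
    (c : EuclideanSpace ℝ (Fin n) → EuclideanSpace ℝ (Fin m))
    (xbar : EuclideanSpace ℝ (Fin n)) : Prop :=
  c xbar ∈ dom g ∧ ∀ x, objective f g c xbar ≤ objective f g c x

/-- `xbar` is stationary: there is a multiplier `ybar ∈ ∂g (c xbar)` such that the gradient of
`f + ⟨ybar, c(·)⟩` (which is the `x`-gradient of the Lagrangian) vanishes at `xbar`. -/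
def IsStationaryPt (f : EuclideanSpace ℝ (Fin n) → ℝ) (g : EuclideanSpace ℝ (Fin m) → EReal)
    (c : EuclideanSpace ℝ (Fin n) → EuclideanSpace ℝ (Fin m))
    (xbar : EuclideanSpace ℝ (Fin n)) : Prop :=
  ∃ ybar ∈ subdiff g (c xbar),
    HasGradientAt (fun x => f x + inner ℝ ybar (c x)) 0 xbar

/-- The value function `V u = inf_x (f x + g (c x - u))`. -/
noncomputable def valueFun (f : EuclideanSpace ℝ (Fin n) → ℝ)
    (g : EuclideanSpace ℝ (Fin m) → EReal)
    (c : EuclideanSpace ℝ (Fin n) → EuclideanSpace ℝ (Fin m))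
    (u : EuclideanSpace ℝ (Fin m)) : EReal :=
  ⨅ x, ((f x : EReal) + g (c x - u))

/-- The standing assumptions on a fully convex composite problem. The field `c_convex` is
`(-hzn g)`-convexity of `c`. -/
structure FullyConvex (f : EuclideanSpace ℝ (Fin n) → ℝ) (g : EuclideanSpace ℝ (Fin m) → EReal)
    (c : EuclideanSpace ℝ (Fin n) → EuclideanSpace ℝ (Fin m)) : Prop where
  f_smooth : ContDiff ℝ 1 f
  f_convex : ConvexOn ℝ Set.univ f
  g_proper : IsProper g
  g_lsc : LowerSemicontinuous g
  g_convex : IsConvexFun g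
  c_smooth : ContDiff ℝ 1 c
  c_convex : ∀ x x' : EuclideanSpace ℝ (Fin n), ∀ t ∈ Set.Icc (0 : ℝ) 1,
    c (t • x + (1 - t) • x') - t • c x - (1 - t) • c x' ∈ hzn g
  exists_minimizer : ∃ xbar, IsMinimizer f g c xbar

/-- The augmented Lagrangian
`L_μ(x, y) = f x + inf_z (g z + ⟨y, c x - z⟩ + ‖c x - z‖² / (2 μ))`, for `μ > 0`. -/
noncomputable def augLagrangian (f : EuclideanSpace ℝ (Fin n) → ℝ)
    (g : EuclideanSpace ℝ (Fin m) → EReal)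
    (c : EuclideanSpace ℝ (Fin n) → EuclideanSpace ℝ (Fin m)) (μ : ℝ)
    (x : EuclideanSpace ℝ (Fin n)) (y : EuclideanSpace ℝ (Fin m)) : EReal :=
  (f x : EReal) +
    ⨅ z, (g z + ((inner ℝ y (c x - z) + 1 / (2 * μ) * ‖c x - z‖ ^ 2 : ℝ) : EReal))

/-- The sequences `x, z, y, yhat` are generated by the safeguarded augmented Lagrangian method with
safeguarding set `Ysg` and reduction factor `β`, where `μ` is the sequence of penalty parameters and
`ε` is the sequence of inexactness parameters. The initial data are `y 0` and `μ 0`. -/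
structure SafeguardedALM (f : EuclideanSpace ℝ (Fin n) → ℝ)
    (g : EuclideanSpace ℝ (Fin m) → EReal)
    (c : EuclideanSpace ℝ (Fin n) → EuclideanSpace ℝ (Fin m))
    (Ysg : Set (EuclideanSpace ℝ (Fin m))) (β : ℝ) (μ ε : ℕ → ℝ)
    (x : ℕ → EuclideanSpace ℝ (Fin n)) (z y yhat : ℕ → EuclideanSpace ℝ (Fin m)) : Prop where
  Ysg_nonempty : Ysg.Nonempty
  Ysg_convex : Convex ℝ Ysg
  Ysg_compact : IsCompact Ysg
  β_mem : β ∈ Set.Ioo (0 : ℝ) 1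
  μ_zero_pos : 0 < μ 0
  yhat_eq : ∀ k, IsProj Ysg (y k) (yhat k)
  ε_nonneg : ∀ k, 0 ≤ ε k
  x_approx : ∀ k, augLagrangian f g c (μ k) (x k) (yhat k) ≤
    (⨅ x', augLagrangian f g c (μ k) x' (yhat k)) + (ε k : EReal)
  z_eq : ∀ k, IsProx (fun w => (μ k : EReal) * g w) (c (x k) + μ k • yhat k) (z k)
  y_succ : ∀ k, y (k + 1) = yhat k + (μ k)⁻¹ • (c (x k) - z k)
  μ_succ : ∀ k, ∃ βk ∈ Set.Ioc 0 β ∪ {1}, μ (k + 1) = βk * μ k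

/-- The adaptive penalty update: for some `θ ∈ (0, 1)`, the penalty parameter is kept if `k = 0` or if
the residual `‖c (x k) - z k‖` has decreased at least by the factor `θ`, and is multiplied by `β`
otherwise. -/
def AdaptivePenalty (c : EuclideanSpace ℝ (Fin n) → EuclideanSpace ℝ (Fin m)) (β : ℝ) (μ : ℕ → ℝ)
    (x : ℕ → EuclideanSpace ℝ (Fin n)) (z : ℕ → EuclideanSpace ℝ (Fin m)) : Prop :=
  ∃ θ ∈ Set.Ioo (0 : ℝ) 1, ∀ k,
    ((k = 0 ∨ ‖c (x k) - z k‖ ≤ θ * ‖c (x (k - 1)) - z (k - 1)‖) → μ (k + 1) = μ k) ∧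
    (¬(k = 0 ∨ ‖c (x k) - z k‖ ≤ θ * ‖c (x (k - 1)) - z (k - 1)‖) → μ (k + 1) = β * μ k)

end Problem

end ConvexComposite

open ConvexComposite

namespace ConvexComposite

/-! ### Convexity and proximal points -/

section Convexity

variable {E : Type*} [NormedAddCommGroup E] [InnerProductSpace ℝ E]

/-! Write `V` for the value function and `r = c x - z` for the residual. A pair `(x, z)` has value
at least `V r`, so once the residuals vanish, lower semicontinuity of `V` at `0` bounds the limiting
values from below by `V 0`, the minimum. Approximate minimality bounds them above by the minimum
plus `ε k - ⟨yhat k, r⟩`, and the safeguarded `yhat k` are bounded.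

The crux is that residuals vanish. If `μ` stays away from `0`, the penalty test eventually always
succeeds and they decay geometrically. If `μ → 0`, the quadratic penalty must beat any decrease of
`V`, and that decrease is at most linear by `exists_linear_minorant`. `V` need not have a
subgradient at `0`, so the minorant keeps a slack of `1`; the factor `μ` absorbs it. -/

theorem IsConvexFun.le_of_le {φ : E → EReal} (h : IsConvexFun φ) {z w : E} {a b t : ℝ}
    (hz : φ z ≤ a) (hw : φ w ≤ b) (ht0 : 0 ≤ t) (ht1 : t ≤ 1) :
    φ (t • z + (1 - t) • w) ≤ ((t * a + (1 - t) * b : ℝ) : EReal) := by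
  have := h (x := (z, a)) hz (y := (w, b)) hw ht0 (sub_nonneg.2 ht1) (by ring)
  simpa [epi] using this

/-- Up to rescaling, the proximal point minimizes the inner problem of the augmented Lagrangian. -/
theorem IsProx.le_real {g : E → EReal} {μ : ℝ} (hμ : 0 < μ) {a y z w : E} {G H : ℝ}
    (h : IsProx (fun w => (μ : EReal) * g w) (a + μ • y) z) (hz : g z = G) (hw : g w = H) :
    G + (inner ℝ y (a - z) + 1 / (2 * μ) * ‖a - z‖ ^ 2) ≤
      H + (inner ℝ y (a - w) + 1 / (2 * μ) * ‖a - w‖ ^ 2) := by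
  have key := h w
  simp only [hz, hw] at key
  norm_cast at key
  -- Completing the square: the two objectives differ by the factor `μ` and a constant in `‖y‖`,
  -- which cancels.
  have expand : ∀ v : E, ‖v - (a + μ • y)‖ ^ 2 =
      ‖a - v‖ ^ 2 + 2 * μ * inner ℝ y (a - v) + μ ^ 2 * ‖y‖ ^ 2 := by
    intro v
    have e : v - (a + μ • y) = -((a - v) + μ • y) := by abel
    rw [e, norm_neg, norm_add_sq_real, inner_smul_right, norm_smul, real_inner_comm, mul_pow,
      Real.norm_eq_abs, sq_abs]
    ring
  rw [expand, expand] at key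
  have aux : ∀ T v, T + (inner ℝ y (a - v) + 1 / (2 * μ) * ‖a - v‖ ^ 2) =
      (μ * T + 1 / 2 * (‖a - v‖ ^ 2 + 2 * μ * inner ℝ y (a - v))) / μ := by
    intro T v
    field_simp
    ring
  rw [aux, aux]
  gcongr ?_ / μ
  linarith

theorem IsProx.ne_top {g : E → EReal} (hg : IsProper g) {μ : ℝ} (hμ : 0 < μ) {a z : E}
    (h : IsProx (fun w => (μ : EReal) * g w) a z) : g z ≠ ⊤ := by
  intro hz
  obtain ⟨w, hw⟩ := hg.1
  have key := h w
  obtain ⟨H, hH⟩ : ∃ H : ℝ, g w = H := ⟨_, (EReal.coe_toReal (ne_of_lt hw) (hg.2 w)).symm⟩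
  simp only [hz, hH, EReal.coe_mul_top_of_pos hμ] at key
  rw [EReal.top_add_coe, top_le_iff] at key
  exact EReal.coe_ne_top (μ * H + 1 / 2 * ‖w - a‖ ^ 2) (by exact_mod_cast key)

end Convexity

variable {n m : ℕ} {f : EuclideanSpace ℝ (Fin n) → ℝ} {g : EuclideanSpace ℝ (Fin m) → EReal}
  {c : EuclideanSpace ℝ (Fin n) → EuclideanSpace ℝ (Fin m)}

/-! ### The value function -/

theorem valueFun_zero : valueFun f g c 0 = minValue f g c := by
  simp [valueFun, minValue, objective]

theorem valueFun_le (x : EuclideanSpace ℝ (Fin n)) (z : EuclideanSpace ℝ (Fin m)) :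
    valueFun f g c (c x - z) ≤ (f x : EReal) + g z := by
  refine (iInf_le _ x).trans ?_
  rw [sub_sub_cancel]

theorem FullyConvex.exists_real_minimizer (hP : FullyConvex f g c) :
    ∃ (xs : EuclideanSpace ℝ (Fin n)) (G : ℝ), g (c xs) = G ∧
      minValue f g c = ((f xs + G : ℝ) : EReal) := by
  obtain ⟨xs, hdom, hmin⟩ := hP.exists_minimizer
  have hG : g (c xs) = (g (c xs)).toReal :=
    (EReal.coe_toReal (ne_of_lt hdom) (hP.g_proper.2 _)).symm
  refine ⟨xs, _, hG, le_antisymm ?_ ?_⟩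
  · refine (iInf_le _ xs).trans ?_
    rw [objective, EReal.coe_add, ← hG]
  · rw [EReal.coe_add, ← hG]
    exact le_iInf hmin

/-- Convexity of the value function along segments that start at the origin. -/
theorem FullyConvex.valueFun_smul_le (hP : FullyConvex f g c) {P : ℝ}
    (hPv : minValue f g c = P) {x : EuclideanSpace ℝ (Fin n)} {z : EuclideanSpace ℝ (Fin m)}
    {G t : ℝ} (hz : g z = G) (ht0 : 0 ≤ t) (ht1 : t ≤ 1) :
    valueFun f g c (t • (c x - z)) ≤ ((t * (f x + G) + (1 - t) * P : ℝ) : EReal) := by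
  obtain ⟨xs, H, hH, hmin⟩ := hP.exists_real_minimizer
  have hPH : P = f xs + H := by exact_mod_cast hPv.symm.trans hmin
  have hg := hP.g_convex.le_of_le hz.le hH.le ht0 ht1
  -- Horizon directions act only on `dom g`; `hg` puts the convex combination there.
  have hv := hP.c_convex x xs t ⟨ht0, ht1⟩ _ (hg.trans_lt (EReal.coe_lt_top _))
  have hf := hP.f_convex.2 (Set.mem_univ x) (Set.mem_univ xs) ht0 (sub_nonneg.2 ht1) (by ring)
  simp only [smul_eq_mul] at hf
  refine (iInf_le _ (t • x + (1 - t) • xs)).trans ?_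
  have e : c (t • x + (1 - t) • xs) - t • (c x - z) = t • z + (1 - t) • c xs +
      (c (t • x + (1 - t) • xs) - t • c x - (1 - t) • c xs) := by
    rw [smul_sub]; abel
  rw [e]
  refine (add_le_add (EReal.coe_le_coe_iff.2 hf) (hv.trans hg)).trans ?_
  rw [← EReal.coe_add, EReal.coe_le_coe_iff, hPH]
  exact le_of_eq (by ring)

/-- If the value function is lower semicontinuous at the origin, then the perturbed objective values
decrease at most linearly in the size of the perturbation. -/
theorem FullyConvex.exists_linear_minorant (hP : FullyConvex f g c) {P : ℝ}
    (hPv : minValue f g c = P) (hV : LowerSemicontinuousAt (valueFun f g c) 0) :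
    ∃ K : ℝ, 0 ≤ K ∧ ∀ x z, ∀ G : ℝ, g z = G → P - 1 - K * ‖c x - z‖ ≤ f x + G := by
  have hlt : ((P - 1 : ℝ) : EReal) < valueFun f g c 0 := by
    rw [valueFun_zero, hPv]
    exact_mod_cast sub_one_lt P
  obtain ⟨δ, hδ, hball⟩ := Metric.eventually_nhds_iff.1 (hV _ hlt)
  refine ⟨2 / δ, by positivity, fun x z G hz => ?_⟩
  set r := ‖c x - z‖ with hr
  have hr0 : 0 ≤ r := norm_nonneg _
  -- Shrinking the residual by `t` brings it into the ball where `V > P - 1`; convexity towards the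
  -- minimizer, divided by `t`, transfers the bound back.
  have main : ∀ t : ℝ, 0 < t → t ≤ 1 → t * r < δ → P - t⁻¹ ≤ f x + G := by
    intro t ht0 ht1 htr
    have h1 := hball (y := t • (c x - z)) (by
      rwa [dist_zero_right, norm_smul, Real.norm_of_nonneg ht0.le])
    have h2 := h1.trans_le (hP.valueFun_smul_le hPv hz ht0.le ht1)
    have h3 : P - 1 < t * (f x + G) + (1 - t) * P := by exact_mod_cast h2
    have h4 : t * (P - t⁻¹) ≤ t * (f x + G) := by
      rw [mul_sub, mul_inv_cancel₀ ht0.ne']; linarith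
    exact le_of_mul_le_mul_left h4 ht0
  have hden : 0 < 1 + 2 / δ * r := by positivity
  -- For this `t`, `t * r < δ / 2` and `t⁻¹` is affine in `r`.
  have := main (1 + 2 / δ * r)⁻¹ (inv_pos.2 hden)
    (inv_le_one_of_one_le₀ (le_add_of_nonneg_right (by positivity))) (by
      rw [inv_mul_lt_iff₀ hden, add_mul, div_mul_eq_mul_div, div_mul_cancel₀ _ hδ.ne']
      linarith)
  rw [inv_inv] at this
  linarith

/-! ### Estimates along the iterates -/

section Algorithm

variable {Ysg : Set (EuclideanSpace ℝ (Fin m))} {β : ℝ} {μ ε : ℕ → ℝ}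
  {x : ℕ → EuclideanSpace ℝ (Fin n)} {z y yhat : ℕ → EuclideanSpace ℝ (Fin m)}

theorem SafeguardedALM.penalty_pos (h : SafeguardedALM f g c Ysg β μ ε x z y yhat) (k : ℕ) :
    0 < μ k := by
  induction k with
  | zero => exact h.μ_zero_pos
  | succ k ih =>
    obtain ⟨b, hb, hk⟩ := h.μ_succ k
    rw [hk]
    rcases hb with hb | rfl
    · exact mul_pos hb.1 ih
    · simpa using ih

theorem SafeguardedALM.penalty_antitone (h : SafeguardedALM f g c Ysg β μ ε x z y yhat) :
    Antitone μ := by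
  refine antitone_nat_of_succ_le fun k => ?_
  obtain ⟨b, hb, hk⟩ := h.μ_succ k
  have hb1 : b ≤ 1 := by
    rcases hb with hb | rfl
    · exact hb.2.trans h.β_mem.2.le
    · exact le_rfl
  rw [hk]
  exact mul_le_of_le_one_left (h.penalty_pos k).le hb1

theorem SafeguardedALM.exists_multiplier_bound
    (h : SafeguardedALM f g c Ysg β μ ε x z y yhat) : ∃ B : ℝ, ∀ k, ‖yhat k‖ ≤ B := by
  obtain ⟨B, hB⟩ := h.Ysg_compact.isBounded.exists_norm_le
  exact ⟨B, fun k => hB _ (h.yhat_eq k).1⟩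

theorem SafeguardedALM.exists_real_value (hP : FullyConvex f g c)
    (h : SafeguardedALM f g c Ysg β μ ε x z y yhat) (k : ℕ) : ∃ G : ℝ, g (z k) = G :=
  ⟨_, (EReal.coe_toReal ((h.z_eq k).ne_top hP.g_proper (h.penalty_pos k))
    (hP.g_proper.2 _)).symm⟩

/-- The value of the augmented Lagrangian at an iterate exceeds the minimal value by at most the
inexactness parameter. -/
theorem SafeguardedALM.augLagrangian_le (hP : FullyConvex f g c)
    (h : SafeguardedALM f g c Ysg β μ ε x z y yhat) {P : ℝ} (hPv : minValue f g c = P) {k : ℕ}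
    {G : ℝ} (hG : g (z k) = G) :
    f (x k) + G + inner ℝ (yhat k) (c (x k) - z k) +
      1 / (2 * μ k) * ‖c (x k) - z k‖ ^ 2 ≤ P + ε k := by
  have lower : ((f (x k) + (G + (inner ℝ (yhat k) (c (x k) - z k) +
      1 / (2 * μ k) * ‖c (x k) - z k‖ ^ 2)) : ℝ) : EReal) ≤
      augLagrangian f g c (μ k) (x k) (yhat k) := by
    rw [augLagrangian, EReal.coe_add]
    gcongr
    refine le_iInf fun w => ?_
    rcases eq_or_ne (g w) ⊤ with hw | hw
    · rw [hw, EReal.top_add_coe]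
      exact le_top
    · have hH := (EReal.coe_toReal hw (hP.g_proper.2 w)).symm
      have := (h.z_eq k).le_real (h.penalty_pos k) hG hH
      rw [hH]
      exact_mod_cast this
  have upper : (⨅ x', augLagrangian f g c (μ k) x' (yhat k)) ≤ (P : EReal) := by
    rw [← hPv]
    refine iInf_mono fun x' => ?_
    rw [augLagrangian, objective]
    gcongr
    -- At `z = c x'` the multiplier and penalty terms vanish.
    refine (iInf_le _ (c x')).trans (by simp)
  have := lower.trans ((h.x_approx k).trans (add_le_add_left upper _))
  have h' : f (x k) + (G + (inner ℝ (yhat k) (c (x k) - z k) +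
      1 / (2 * μ k) * ‖c (x k) - z k‖ ^ 2)) ≤ P + ε k := by exact_mod_cast this
  linarith

theorem SafeguardedALM.residual_tendsto_of_penalty_tendsto (hP : FullyConvex f g c)
    (hV : LowerSemicontinuousAt (valueFun f g c) 0)
    (h : SafeguardedALM f g c Ysg β μ ε x z y yhat) (hε : Tendsto ε atTop (𝓝 0))
    (hμ : Tendsto μ atTop (𝓝 0)) :
    Tendsto (fun k => ‖c (x k) - z k‖) atTop (𝓝 0) := by
  obtain ⟨xs, H, -, hPv⟩ := hP.exists_real_minimizer
  obtain ⟨K, hK, hmin⟩ := hP.exists_linear_minorant hPv hV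
  obtain ⟨B, hB⟩ := h.exists_multiplier_bound
  obtain ⟨E, hE⟩ := hε.bddAbove_range
  have hE' : ∀ k, ε k ≤ E := fun k => hE ⟨k, rfl⟩
  have bound : ∀ k, ‖c (x k) - z k‖ ^ 2 ≤
      4 * μ k * (1 + E) + 4 * μ k ^ 2 * (K + B) ^ 2 := by
    intro k
    obtain ⟨G, hG⟩ := h.exists_real_value hP k
    have h1 := h.augLagrangian_le hP hPv hG
    have h2 := hmin (x k) (z k) G hG
    have h3 := (abs_le.1 (abs_real_inner_le_norm (yhat k) (c (x k) - z k))).1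
    have hpos := h.penalty_pos k
    set r := ‖c (x k) - z k‖ with hr
    have h4 : ‖yhat k‖ * r ≤ B * r := mul_le_mul_of_nonneg_right (hB k) (norm_nonneg _)
    have h5 : 1 / (2 * μ k) * r ^ 2 ≤ 1 + E + (K + B) * r := by linarith [hE' k]
    have h6 : r ^ 2 ≤ 2 * μ k * (1 + E + (K + B) * r) := by
      rw [one_div, inv_mul_le_iff₀ (by positivity)] at h5
      exact h5
    -- Young's inequality absorbs the linear term into half of `r ^ 2`.
    linarith [sq_nonneg (r - 2 * μ k * (K + B))]
  have hlim : Tendsto (fun k => 4 * μ k * (1 + E) + 4 * μ k ^ 2 * (K + B) ^ 2) atTop (𝓝 0) := by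
    have := ((hμ.const_mul 4).mul_const (1 + E)).add
      (((hμ.pow 2).const_mul 4).mul_const ((K + B) ^ 2))
    simpa using this
  have hsq := (squeeze_zero (fun k => sq_nonneg _) bound hlim).sqrt
  simpa using hsq

theorem SafeguardedALM.residual_tendsto_of_not_penalty_tendsto
    (h : SafeguardedALM f g c Ysg β μ ε x z y yhat) (hpenalty : AdaptivePenalty c β μ x z)
    (hμ : ¬ Tendsto μ atTop (𝓝 0)) :
    Tendsto (fun k => ‖c (x k) - z k‖) atTop (𝓝 0) := by
  obtain ⟨θ, hθ, hstep⟩ := hpenalty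
  have hbdd : BddBelow (Set.range μ) := ⟨0, by rintro _ ⟨k, rfl⟩; exact (h.penalty_pos k).le⟩
  have hlim := tendsto_atTop_ciInf h.penalty_antitone hbdd
  set L := ⨅ k, μ k with hL
  have hL0 : L ≠ 0 := fun h0 => hμ (h0 ▸ hlim)
  -- The difference tends to `(1 - β) * L ≠ 0`, so the reduction branch is eventually impossible.
  have hne : ∀ᶠ k in atTop, μ (k + 1) - β * μ k ≠ 0 := by
    have h1 : Tendsto (fun k => μ (k + 1) - β * μ k) atTop (𝓝 (L - β * L)) :=
      (hlim.comp (tendsto_add_atTop_nat 1)).sub (hlim.const_mul β)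
    refine h1.eventually_ne ?_
    have : L - β * L = (1 - β) * L := by ring
    rw [this]
    exact mul_ne_zero (sub_pos.2 h.β_mem.2).ne' hL0
  obtain ⟨N, hN⟩ := eventually_atTop.1 hne
  have hdec : ∀ j, ‖c (x (N + 1 + j)) - z (N + 1 + j)‖ ≤
      θ ^ j * ‖c (x (N + 1)) - z (N + 1)‖ := by
    intro j
    induction j with
    | zero => simp
    | succ j ih =>
      have hk := hN (N + 1 + (j + 1)) (by omega)
      have hcond : (N + 1 + (j + 1) = 0 ∨ _) :=
        not_not.1 fun hc => hk (sub_eq_zero.2 ((hstep (N + 1 + (j + 1))).2 hc))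
      have := hcond.resolve_left (by omega)
      rw [show N + 1 + (j + 1) - 1 = N + 1 + j by omega] at this
      refine this.trans ((mul_le_mul_of_nonneg_left ih hθ.1.le).trans_eq ?_)
      ring
  have hgeo : Tendsto (fun j => θ ^ j * ‖c (x (N + 1)) - z (N + 1)‖) atTop (𝓝 0) := by
    simpa using (tendsto_pow_atTop_nhds_zero_of_lt_one hθ.1.le hθ.2).mul_const
      ‖c (x (N + 1)) - z (N + 1)‖
  have := squeeze_zero (fun j => norm_nonneg _) hdec hgeo
  refine (tendsto_add_atTop_iff_nat (N + 1)).1 (this.congr fun j => ?_)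
  rw [add_comm]

/-- The infeasibilities of the iterates of the safeguarded method vanish. -/
theorem SafeguardedALM.residual_tendsto (hP : FullyConvex f g c)
    (hV : LowerSemicontinuousAt (valueFun f g c) 0)
    (h : SafeguardedALM f g c Ysg β μ ε x z y yhat) (hpenalty : AdaptivePenalty c β μ x z)
    (hε : Tendsto ε atTop (𝓝 0)) :
    Tendsto (fun k => c (x k) - z k) atTop (𝓝 0) := by
  rw [tendsto_zero_iff_norm_tendsto_zero]
  by_cases hμ : Tendsto μ atTop (𝓝 0)
  · exact h.residual_tendsto_of_penalty_tendsto hP hV hε hμ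
  · exact h.residual_tendsto_of_not_penalty_tendsto hpenalty hμ

/-- The objective values of the iterates are bounded above by a real sequence that converges to the
minimal value. -/
theorem SafeguardedALM.exists_upper_bound (hP : FullyConvex f g c)
    (h : SafeguardedALM f g c Ysg β μ ε x z y yhat) {P : ℝ} (hPv : minValue f g c = P)
    (hr : Tendsto (fun k => c (x k) - z k) atTop (𝓝 0)) (hε : Tendsto ε atTop (𝓝 0)) :
    ∃ u : ℕ → ℝ, Tendsto u atTop (𝓝 P) ∧ ∀ k, (f (x k) : EReal) + g (z k) ≤ (u k : EReal) := by
  obtain ⟨B, hB⟩ := h.exists_multiplier_bound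
  refine ⟨fun k => P + ε k + B * ‖c (x k) - z k‖, ?_, fun k => ?_⟩
  · simpa using (hε.const_add P).add (hr.norm.const_mul B)
  · obtain ⟨G, hG⟩ := h.exists_real_value hP k
    have h1 := h.augLagrangian_le hP hPv hG
    have h2 := (abs_le.1 (abs_real_inner_le_norm (yhat k) (c (x k) - z k))).1
    have h3 := mul_le_mul_of_nonneg_right (hB k) (norm_nonneg (c (x k) - z k))
    have hpos := h.penalty_pos k
    have h4 : 0 ≤ 1 / (2 * μ k) * ‖c (x k) - z k‖ ^ 2 := by positivity
    rw [hG]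
    norm_cast
    linarith

end Algorithm

/-! ### Passage to the limit -/

/-- Vanishing residuals and asymptotically optimal values force the objective values to converge. -/
theorem tendsto_value_of_residual_tendsto (hV : LowerSemicontinuousAt (valueFun f g c) 0) {P : ℝ}
    (hPv : minValue f g c = P) {x : ℕ → EuclideanSpace ℝ (Fin n)}
    {z : ℕ → EuclideanSpace ℝ (Fin m)} {u : ℕ → ℝ}
    (hr : Tendsto (fun k => c (x k) - z k) atTop (𝓝 0)) (hu : Tendsto u atTop (𝓝 P))
    (hle : ∀ k, (f (x k) : EReal) + g (z k) ≤ (u k : EReal)) :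
    Tendsto (fun k => (f (x k) : EReal) + g (z k)) atTop (𝓝 (P : EReal)) := by
  have hu' : Tendsto (fun k => (u k : EReal)) atTop (𝓝 (P : EReal)) := EReal.tendsto_coe.2 hu
  refine tendsto_order.2 ⟨fun a ha => ?_, fun b hb => ?_⟩
  · rw [← hPv, ← valueFun_zero] at ha
    filter_upwards [hr.eventually (hV a ha)] with k hk
    exact hk.trans_le (valueFun_le _ _)
  · filter_upwards [(tendsto_order.1 hu').2 b hb] with k hk
    exact (hle k).trans_lt hk

theorem FullyConvex.isMinimizer_of_tendsto (hP : FullyConvex f g c) {P : ℝ}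
    (hPv : minValue f g c = P) {x : ℕ → EuclideanSpace ℝ (Fin n)}
    {z : ℕ → EuclideanSpace ℝ (Fin m)} {u : ℕ → ℝ} {xbar : EuclideanSpace ℝ (Fin n)}
    (hx : Tendsto x atTop (𝓝 xbar)) (hz : Tendsto z atTop (𝓝 (c xbar)))
    (hu : Tendsto u atTop (𝓝 P)) (hle : ∀ k, (f (x k) : EReal) + g (z k) ≤ (u k : EReal)) :
    IsMinimizer f g c xbar := by
  have hg : g (c xbar) ≤ ((P - f xbar : ℝ) : EReal) := by
    -- Otherwise a real `a` lies strictly between; eventually `g (z k) > a` by lower semicontinuity,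
    -- while `u k - f (x k) < a`.
    by_contra! hlt
    obtain ⟨a, ha1, ha2⟩ := EReal.lt_iff_exists_real_btwn.1 hlt
    have hf : Tendsto (fun k => u k - f (x k)) atTop (𝓝 (P - f xbar)) :=
      hu.sub ((hP.f_smooth.continuous.tendsto xbar).comp hx)
    obtain ⟨k, hk1, hk2⟩ := ((hz.eventually (hP.g_lsc _ _ ha2)).and
      ((tendsto_order.1 hf).2 a (by exact_mod_cast ha1))).exists
    have h3 : (f (x k) : EReal) + a ≤ u k := (add_le_add le_rfl hk1.le).trans (hle k)
    have h4 : f (x k) + a ≤ u k := by exact_mod_cast h3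
    linarith
  refine ⟨hg.trans_lt (EReal.coe_lt_top _), fun x' => ?_⟩
  have hobj : objective f g c xbar ≤ minValue f g c := by
    rw [hPv]
    refine (add_le_add le_rfl hg).trans ?_
    rw [← EReal.coe_add, add_sub_cancel]
  exact hobj.trans (iInf_le _ x')

end ConvexComposite

open ConvexComposite
theorem proposition5p10 {n m : ℕ}
    (f : EuclideanSpace ℝ (Fin n) → ℝ) (g : EuclideanSpace ℝ (Fin m) → EReal)
    (c : EuclideanSpace ℝ (Fin n) → EuclideanSpace ℝ (Fin m))
    (hP : FullyConvex f g c)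
    (hirr : ∀ xbar, IsMinimizer f g c xbar → ¬ IsStationaryPt f g c xbar)
    (hVproper : IsProper (valueFun f g c)) (hVlsc : LowerSemicontinuous (valueFun f g c))
    (Ysg : Set (EuclideanSpace ℝ (Fin m))) (β : ℝ) (μ ε : ℕ → ℝ)
    (x : ℕ → EuclideanSpace ℝ (Fin n)) (z y yhat : ℕ → EuclideanSpace ℝ (Fin m))
    (hALM : SafeguardedALM f g c Ysg β μ ε x z y yhat)
    (hpenalty : AdaptivePenalty c β μ x z)
    (hε : Tendsto ε atTop (𝓝 0)) :
    limsup (fun k => (f (x k) : EReal) + g (z k)) atTop ≤ minValue f g c ∧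
    (∀ xbar, MapClusterPt xbar atTop x → IsMinimizer f g c xbar) ∧
    (∀ (xbar : EuclideanSpace ℝ (Fin n)) (φ : ℕ → ℕ), StrictMono φ →
      Tendsto (fun j => x (φ j)) atTop (𝓝 xbar) →
        Tendsto (fun j => z (φ j)) atTop (𝓝 (c xbar)) ∧
        Tendsto (fun j => (f (x (φ j)) : EReal) + g (z (φ j))) atTop
          (𝓝 (minValue f g c))) := by
  obtain ⟨xs, H, -, hPv⟩ := hP.exists_real_minimizer
  have hV := hVlsc 0
  have hr := hALM.residual_tendsto hP hV hpenalty hε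
  obtain ⟨u, hu, hle⟩ := hALM.exists_upper_bound hP hPv hr hε
  have hval := tendsto_value_of_residual_tendsto hV hPv hr hu hle
  have hz : ∀ (xbar : EuclideanSpace ℝ (Fin n)) (φ : ℕ → ℕ), StrictMono φ →
      Tendsto (fun j => x (φ j)) atTop (𝓝 xbar) →
        Tendsto (fun j => z (φ j)) atTop (𝓝 (c xbar)) := by
    intro xbar φ hφ hx
    have h1 := ((hP.c_smooth.continuous.tendsto xbar).comp hx).sub (hr.comp hφ.tendsto_atTop)
    simpa [Function.comp_def] using h1
  refine ⟨?_, fun xbar hxbar => ?_, fun xbar φ hφ hx => ⟨hz xbar φ hφ hx, ?_⟩⟩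
  · rw [hPv]
    exact hval.limsup_eq.le
  · obtain ⟨φ, hφ, hx⟩ := hxbar.tendsto_subseq
    exact hP.isMinimizer_of_tendsto hPv hx (hz xbar φ hφ hx) (hu.comp hφ.tendsto_atTop)
      fun k => hle (φ k)
  · rw [hPv]
    exact hval.comp hφ.tendsto_atTop
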